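/- Let $n\ge 0$ and let $k_1,\dots,k_I\ge 1$ be integers with $k_1+\cdots+k_I=n$. Let $D(k_1,\dots,k_I)\subset\mathbb{C}^{n\times n}$ be the set of diagonalizable complex $n\times n$ matrices having exactly $I$ distinct eigenvalues $\lambda_1,\dots,\lambda_I$, where $\lambda_i$ has (algebraic) multiplicity $k_i$. Say that a subset $S$ of a finite-dimensional complex vector space $E$ has complex dimension $d$ if it is nonempty and is an embedded, not necessarily closed, complex submanifold of $E$ of pure dimension $d$ (each point of $S$ has an open neighbourhood $U\subset E$ and a biholomorphic map $\varphi:U\to V$ onto an open set $V\subset E$ with $\varphi(S\cap U)=F\cap V$ for some $d$-dimensional complex linear subspace $F\subset E$), and that its complex codimension is then $\dim_{\mathbb{C}} E-d$. Then $D(k_1,\dots,k_I)$ has complex dimension $$n^2-\sum_{i=1}^I k_i^2+I \;=\; n^2-\sum_{i=1}^I (k_i^2-1),$$ and its complex codimension in $\mathbb{C}^{n\times n}$ is $$\sum_{i=1}^I (k_i^2-1).$$ In particular, for every integer $k$ with $1\le k\le n$, the set $D(k,1,\dots,1)$ (with $n-k$ ones) of diagonalizable $n\times n$ matrices with one eigenvalue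 of multiplicity $k$ and all other eigenvalues simple has complex codimension $k^2-1$. -/

import Mathlib

open scoped Matrix

/-- A subset `S` of a finite-dimensional complex vector space `E` is a (locally closed, embedded)
complex submanifold of pure dimension `d`: around each of its points there is a biholomorphic
change of coordinates `φ` between open subsets of `E` which straightens `S` to a complex linear
subspace `F` of dimension `d`. -/
def IsComplexSubmanifold {E : Type*} [NormedAddCommGroup E] [NormedSpace ℂ E]
    [FiniteDimensional ℂ E] (S : Set E) (d : ℕ) : Prop :=
  ∀ x ∈ S, ∃ (φ : OpenPartialHomeomorph E E) (F : Submodule ℂ E),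
    x ∈ φ.source ∧ DifferentiableOn ℂ φ φ.source ∧ DifferentiableOn ℂ φ.symm φ.target ∧
      Module.finrank ℂ F = d ∧ ∀ y ∈ φ.source, y ∈ S ↔ φ y ∈ F

/-- `S` has complex dimension `d`: it is a nonempty complex submanifold of pure dimension `d`. -/
def HasComplexDim {E : Type*} [NormedAddCommGroup E] [NormedSpace ℂ E]
    [FiniteDimensional ℂ E] (S : Set E) (d : ℕ) : Prop :=
  S.Nonempty ∧ IsComplexSubmanifold S d

/-- `S` has complex codimension `c` in `E`: it has a complex dimension, and `c` is the dimension
of `E` minus the dimension of `S`. -/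
def HasComplexCodim {E : Type*} [NormedAddCommGroup E] [NormedSpace ℂ E]
    [FiniteDimensional ℂ E] (S : Set E) (c : ℕ) : Prop :=
  ∃ d : ℕ, HasComplexDim S d ∧ d + c = Module.finrank ℂ E

/-- A nonempty set determines the dimension for which it is a complex submanifold. -/
theorem IsComplexSubmanifold.dim_le {E : Type*} [NormedAddCommGroup E] [NormedSpace ℂ E]
    [FiniteDimensional ℂ E] {S : Set E} {d e : ℕ} (hne : S.Nonempty)
    (hd : IsComplexSubmanifold S d) (he : IsComplexSubmanifold S e) : d ≤ e := by
  obtain ⟨x, hx⟩ := hne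
  obtain ⟨φ, F, hxφ, hφ, hφ', rfl, hF⟩ := hd x hx
  obtain ⟨ψ, G, hxψ, hψ, hψ', rfl, hG⟩ := he x hx
  have hφx : φ x ∈ φ.target := φ.map_source hxφ
  have hψx : ψ x ∈ ψ.target := ψ.map_source hxψ
  have d1 : DifferentiableAt ℂ φ x := hφ.differentiableAt (φ.open_source.mem_nhds hxφ)
  have d2 : DifferentiableAt ℂ φ.symm (φ x) := hφ'.differentiableAt (φ.open_target.mem_nhds hφx)
  have d3 : DifferentiableAt ℂ ψ x := hψ.differentiableAt (ψ.open_source.mem_nhds hxψ)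
  have d4 : DifferentiableAt ℂ ψ.symm (ψ x) := hψ'.differentiableAt (ψ.open_target.mem_nhds hψx)
  have hsx : φ.symm (φ x) = x := φ.left_inv hxφ
  have hg : HasFDerivAt (fun z => ψ (φ.symm z))
      ((fderiv ℂ ψ x).comp (fderiv ℂ φ.symm (φ x))) (φ x) := by
    have h3 : HasFDerivAt ψ (fderiv ℂ ψ x) (φ.symm (φ x)) := by
      rw [hsx]; exact d3.hasFDerivAt
    exact h3.comp (φ x) d2.hasFDerivAt
  have i1 : ∀ v, fderiv ℂ φ x (fderiv ℂ φ.symm (φ x) v) = v := by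
    have h1 : HasFDerivAt φ (fderiv ℂ φ x) (φ.symm (φ x)) := by
      rw [hsx]; exact d1.hasFDerivAt
    have h := h1.comp (φ x) d2.hasFDerivAt
    have h2 : HasFDerivAt (φ ∘ φ.symm) (ContinuousLinearMap.id ℂ E) (φ x) := by
      refine (hasFDerivAt_id (φ x)).congr_of_eventuallyEq ?_
      filter_upwards [φ.open_target.mem_nhds hφx] with z hz using φ.right_inv hz
    intro v
    exact DFunLike.congr_fun (h.unique h2) v
  have i2 : ∀ v, fderiv ℂ ψ.symm (ψ x) (fderiv ℂ ψ x v) = v := by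
    have h := d4.hasFDerivAt.comp x d3.hasFDerivAt
    have h2 : HasFDerivAt (ψ.symm ∘ ψ) (ContinuousLinearMap.id ℂ E) x := by
      refine (hasFDerivAt_id x).congr_of_eventuallyEq ?_
      filter_upwards [ψ.open_source.mem_nhds hxψ] with z hz using ψ.left_inv hz
    intro v
    exact DFunLike.congr_fun (h.unique h2) v
  set L : E →L[ℂ] E := (fderiv ℂ ψ x).comp (fderiv ℂ φ.symm (φ x)) with hL
  have hinj : Function.Injective L := by
    intro v w hvw
    have h : fderiv ℂ φ.symm (φ x) v = fderiv ℂ φ.symm (φ x) w := by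
      rw [← i2 (fderiv ℂ φ.symm (φ x) v), ← i2 (fderiv ℂ φ.symm (φ x) w)]
      exact congrArg _ hvw
    rw [← i1 v, ← i1 w, h]
  have hmap : ∀ v ∈ F, L v ∈ G := by
    intro v hv
    have hc : HasDerivAt (fun t : ℂ => φ x + t • v) v 0 := by
      simpa using ((hasDerivAt_id (0 : ℂ)).smul_const v).const_add (φ x)
    have hgc : HasDerivAt (fun t : ℂ => ψ (φ.symm (φ x + t • v))) (L v) 0 := by
      have hg' : HasFDerivAt (fun z => ψ (φ.symm z)) L (φ x + (0 : ℂ) • v) := by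
        simpa using hg
      exact HasFDerivAt.comp_hasDerivAt (f := fun t : ℂ => φ x + t • v)
        (l := fun z => ψ (φ.symm z)) (0 : ℂ) hg' hc
    have hφxF : φ x ∈ F := (hF x hxφ).1 hx
    have hmem : ∀ᶠ t : ℂ in nhds 0, ψ (φ.symm (φ x + t • v)) ∈ G := by
      have hc0 : Filter.Tendsto (fun t : ℂ => φ x + t • v) (nhds 0) (nhds (φ x)) := by
        simpa using hc.continuousAt.tendsto
      have e1 := hc0.eventually (φ.open_target.mem_nhds hφx)
      have e2 : ∀ᶠ t : ℂ in nhds 0, φ.symm (φ x + t • v) ∈ ψ.source := by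
        refine (d2.continuousAt.tendsto.comp hc0).eventually (ψ.open_source.mem_nhds ?_)
        rwa [hsx]
      filter_upwards [e1, e2] with t h1 h2
      refine (hG _ h2).1 ((hF _ (φ.map_target h1)).2 ?_)
      rw [φ.right_inv h1]
      exact F.add_mem hφxF (F.smul_mem t hv)
    have h0 : ψ (φ.symm (φ x + (0 : ℂ) • v)) ∈ G := hmem.self_of_nhds
    refine G.closed_of_finiteDimensional.mem_of_tendsto (hasDerivAt_iff_tendsto_slope.1 hgc) ?_
    filter_upwards [nhdsWithin_le_nhds hmem] with t ht
    exact G.smul_mem _ (G.sub_mem ht h0)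
  exact LinearMap.finrank_le_finrank_of_injective
    (f := (L : E →ₗ[ℂ] E).restrict hmap)
    (fun v w h => Subtype.ext (hinj (congrArg Subtype.val h)))

/-- A set has at most one complex dimension. -/
theorem HasComplexDim.unique {E : Type*} [NormedAddCommGroup E] [NormedSpace ℂ E]
    [FiniteDimensional ℂ E] {S : Set E} {d e : ℕ}
    (hd : HasComplexDim S d) (he : HasComplexDim S e) : d = e :=
  le_antisymm (IsComplexSubmanifold.dim_le hd.1 hd.2 he.2)
    (IsComplexSubmanifold.dim_le hd.1 he.2 hd.2)

/-- The matrix `A` is diagonalizable: `A = T Λ T⁻¹` with `T` invertible and `Λ` diagonal. -/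
def MatrixDiagonalizable {n : ℕ} (A : Matrix (Fin n) (Fin n) ℂ) : Prop :=
  ∃ (T : Matrix (Fin n) (Fin n) ℂ) (v : Fin n → ℂ),
    IsUnit T.det ∧ A = T * Matrix.diagonal v * T⁻¹

/-- The eigenvalue multiplicities of `A` are `k 0, …, k (I - 1)`: the set of eigenvalues of `A`
consists of `I` distinct numbers `l 0, …, l (I - 1)`, and `l i` has algebraic multiplicity `k i`. -/
def HasEigenvalueMultiplicities {n I : ℕ} (k : Fin I → ℕ)
    (A : Matrix (Fin n) (Fin n) ℂ) : Prop :=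
  ∃ l : Fin I → ℂ, Function.Injective l ∧ Set.range l = spectrum ℂ A ∧
    ∀ i, A.charpoly.rootMultiplicity (l i) = k i

/-- The set of diagonalizable complex `n × n` matrices with eigenvalue multiplicities `k`. -/
def diagonalizableWithMultiplicities (n : ℕ) {I : ℕ} (k : Fin I → ℕ) :
    Set (Matrix (Fin n) (Fin n) ℂ) :=
  {A | MatrixDiagonalizable A ∧ HasEigenvalueMultiplicities k A}

/- A norm on the space of matrices (the largest absolute value of an entry). All norms on this
finite-dimensional space are equivalent, so the choice affects neither open sets nor
holomorphy. -/
attribute [local instance] Matrix.normedAddCommGroup Matrix.normedSpace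

/-!
Let `A = T D T⁻¹` be a point of the set `S` of diagonalizable matrices with multiplicities `k`,
where `D = diagonal (l ∘ c)`: the injective `l : Fin I → ℂ` lists the eigenvalues, and the
colouring `c : Fin n → Fin I` says which eigenvalue stands at which place, so that its fibres
have `k i` elements. The colouring cuts every matrix `Y` into its diagonal blocks `Z`
(`blockPart c Y`), which is the part commuting with `D`, and the rest `W = Y - Z`.

The slice map `f Y = T (1 + W) (D + Z) (1 + W)⁻¹ T⁻¹` has derivative `H ↦ T ([W, D] + Z) T⁻¹` at
`0`, where `W` and `Z` are now the parts of `H`. This is injective: an off-block entry `H p q` gets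
multiplied by the nonzero number `l (c q) - l (c p)`, a block entry stays. By the inverse function
theorem `f` is a local biholomorphism (`exists_straightening`). Since `S` is invariant under
conjugation, `f Y ∈ S` if and only if `D + Z ∈ S`.

For small `Y`, `D + Z ∈ S` if and only if each block of `Z` is scalar (`add_blockPart_mem_iff`).
If `D + Z` is diagonalizable with only `I` eigenvalues, then an eigenvector with a nonzero
component in block `i` has an eigenvalue near `l i`. The `l i` are far apart, so each eigenvector
is supported in one block. As all blocks are met, the `I` eigenvalues correspond bijectively to the
`I` blocks. Hence every eigenvector of `D + Z` is an eigenvector, for the same eigenvalue, of one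
fixed diagonal matrix which is constant on blocks, and `D + Z` equals that matrix.

So the inverse of `f` straightens `S` near `A` to the linear space `scalarBlocks c`, which has
the off-block entries and `I` scalars as coordinates: its dimension is `n² - ∑ kᵢ² + I`
(`finrank_scalarBlocks`, `card_offBlock_add`).
-/

/-! ### Diagonalizable matrices with prescribed multiplicities -/

lemma surjective_of_card_fiber {n I : ℕ} {k : Fin I → ℕ} (hk : ∀ i, 1 ≤ k i)
    {c : Fin n → Fin I} (hc : ∀ i, (Finset.univ.filter fun p => c p = i).card = k i) :
    Function.Surjective c := fun i => by
  have : 0 < (Finset.univ.filter fun p => c p = i).card := by rw [hc]; exact hk i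
  obtain ⟨p, hp⟩ := Finset.card_pos.1 this
  exact ⟨p, by simpa using hp⟩

open Matrix in
lemma conj_diagonal_charpoly {n : ℕ} {T : Matrix (Fin n) (Fin n) ℂ} (hT : IsUnit T.det)
    (v : Fin n → ℂ) :
    (T * diagonal v * T⁻¹).charpoly = (diagonal v).charpoly := by
  obtain ⟨u, rfl⟩ := (Matrix.isUnit_iff_isUnit_det T).2 hT
  simp

open Matrix in
lemma conj_diagonal_spectrum {n : ℕ} {T : Matrix (Fin n) (Fin n) ℂ} (hT : IsUnit T.det)
    (v : Fin n → ℂ) :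
    spectrum ℂ (T * diagonal v * T⁻¹) = Set.range v := by
  obtain ⟨u, rfl⟩ := (Matrix.isUnit_iff_isUnit_det T).2 hT
  rw [← Matrix.coe_units_inv, spectrum.units_conjugate, spectrum_diagonal]

open Matrix in
lemma rootMultiplicity_charpoly_diagonal {n : ℕ} (v : Fin n → ℂ) (a : ℂ) :
    (diagonal v).charpoly.rootMultiplicity a = (Finset.univ.filter fun p => v p = a).card := by
  classical
  rw [charpoly_diagonal, ← Polynomial.count_roots]
  have : (∏ i, (Polynomial.X - Polynomial.C (v i))) =
      ((Finset.univ.val.map v).map fun a => Polynomial.X - Polynomial.C a).prod := by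
    rw [Multiset.map_map]
    rfl
  rw [this, Polynomial.roots_multiset_prod_X_sub_C, Multiset.count_map]
  simp only [Finset.card, Finset.filter_val, eq_comm]

open Matrix in
/-- Membership in terms of a colouring `c` of the diagonal by the indices of the eigenvalues;
this replaces the conditions on the spectrum and the characteristic polynomial. -/
lemma mem_diagonalizableWithMultiplicities_iff {n I : ℕ} {k : Fin I → ℕ} (hk : ∀ i, 1 ≤ k i)
    (A : Matrix (Fin n) (Fin n) ℂ) :
    A ∈ diagonalizableWithMultiplicities n k ↔
      ∃ (T : Matrix (Fin n) (Fin n) ℂ) (l : Fin I → ℂ) (c : Fin n → Fin I),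
        IsUnit T.det ∧ Function.Injective l ∧
        (∀ i, (Finset.univ.filter fun p => c p = i).card = k i) ∧
        A = T * diagonal (l ∘ c) * T⁻¹ := by
  constructor
  · rintro ⟨⟨T, v, hT, rfl⟩, l, hl, hr, hm⟩
    rw [conj_diagonal_spectrum hT] at hr
    have hc : ∀ p, ∃ i, l i = v p := fun p => by
      have : v p ∈ Set.range l := hr ▸ Set.mem_range_self p
      exact this
    choose c hc using hc
    obtain rfl : l ∘ c = v := funext hc
    refine ⟨T, l, c, hT, hl, fun i => ?_, rfl⟩
    rw [← hm i, conj_diagonal_charpoly hT, rootMultiplicity_charpoly_diagonal]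
    simp [hl.eq_iff]
  · rintro ⟨T, l, c, hT, hl, hc, rfl⟩
    refine ⟨⟨T, _, hT, rfl⟩, l, hl, ?_, fun i => ?_⟩
    · rw [conj_diagonal_spectrum hT, (surjective_of_card_fiber hk hc).range_comp]
    · rw [conj_diagonal_charpoly hT, rootMultiplicity_charpoly_diagonal]
      simp [hl.eq_iff, hc]

lemma conj_mem_diagonalizableWithMultiplicities_iff {n I : ℕ} {k : Fin I → ℕ}
    (hk : ∀ i, 1 ≤ k i) {G : Matrix (Fin n) (Fin n) ℂ} (hG : IsUnit G.det)
    (A : Matrix (Fin n) (Fin n) ℂ) :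
    G * A * G⁻¹ ∈ diagonalizableWithMultiplicities n k ↔
      A ∈ diagonalizableWithMultiplicities n k := by
  have key : ∀ {G : Matrix (Fin n) (Fin n) ℂ} (_ : IsUnit G.det) (A : Matrix (Fin n) (Fin n) ℂ),
      A ∈ diagonalizableWithMultiplicities n k →
        G * A * G⁻¹ ∈ diagonalizableWithMultiplicities n k := by
    intro G hG A
    simp only [mem_diagonalizableWithMultiplicities_iff hk]
    rintro ⟨T, l, c, hT, hl, hc, rfl⟩
    refine ⟨G * T, l, c, ?_, hl, hc, ?_⟩
    · rw [Matrix.det_mul]; exact hG.mul hT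
    · simp only [Matrix.mul_inv_rev, Matrix.mul_assoc]
  refine ⟨fun h => ?_, key hG A⟩
  have h' := key (Matrix.isUnit_nonsing_inv_det G hG) _ h
  rwa [Matrix.nonsing_inv_nonsing_inv _ hG, Matrix.mul_assoc G,
    Matrix.nonsing_inv_mul_cancel_left _ _ hG, Matrix.mul_assoc, Matrix.nonsing_inv_mul _ hG,
    Matrix.mul_one] at h'

/-! ### Block diagonal parts -/

/-- The block diagonal part of a matrix: the entries `p q` with `c p = c q` are kept, all others
are replaced by `0`. The blocks are the fibres of `c`, which need not be intervals. -/
def blockPart {n I : ℕ} (c : Fin n → Fin I) :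
    Matrix (Fin n) (Fin n) ℂ →ₗ[ℂ] Matrix (Fin n) (Fin n) ℂ where
  toFun Y := Matrix.of fun p q => if c p = c q then Y p q else 0
  map_add' X Y := by
    ext p q
    simp only [Matrix.of_apply, Matrix.add_apply]
    split_ifs <;> simp
  map_smul' a Y := by
    ext p q
    simp

lemma blockPart_apply {n I : ℕ} (c : Fin n → Fin I) (Y : Matrix (Fin n) (Fin n) ℂ)
    (p q : Fin n) : blockPart c Y p q = if c p = c q then Y p q else 0 := rfl

/-- The matrices whose block diagonal part is a scalar matrix on each block; their entries outside
the diagonal blocks are arbitrary. -/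
def scalarBlocks {n I : ℕ} (c : Fin n → Fin I) : Submodule ℂ (Matrix (Fin n) (Fin n) ℂ) where
  carrier := {Y | ∃ t : Fin I → ℂ, blockPart c Y = Matrix.diagonal (t ∘ c)}
  add_mem' := by
    rintro X Y ⟨s, hs⟩ ⟨t, ht⟩
    refine ⟨s + t, ?_⟩
    rw [map_add, hs, ht, Matrix.diagonal_add]
    rfl
  zero_mem' := ⟨0, by simp⟩
  smul_mem' := by
    rintro a X ⟨s, hs⟩
    refine ⟨a • s, ?_⟩
    rw [map_smul, hs, ← Matrix.diagonal_smul]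
    rfl

/-- The off-block positions and the positions in the blocks, `k i ^ 2` in block `i`, exhaust the
`n ^ 2` positions. -/
lemma card_offBlock_add {n I : ℕ} {k : Fin I → ℕ} (c : Fin n → Fin I)
    (hc : ∀ i, (Finset.univ.filter fun p => c p = i).card = k i) :
    Fintype.card {x : Fin n × Fin n // c x.1 ≠ c x.2} + ∑ i, k i ^ 2 = n ^ 2 := by
  have h1 : Fintype.card {x : Fin n × Fin n // c x.1 = c x.2} = ∑ i, k i ^ 2 := by
    rw [Fintype.card_subtype,
      Finset.card_eq_sum_card_fiberwise (t := Finset.univ) (f := fun x => c x.1) (by simp)]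
    refine Finset.sum_congr rfl fun i _ => ?_
    rw [← hc i, sq, ← Finset.card_product]
    congr 1
    ext ⟨p, q⟩
    simp
    grind
  have h2 := Fintype.card_subtype_compl (fun x : Fin n × Fin n => c x.1 = c x.2)
  have h3 := Fintype.card_subtype_le (fun x : Fin n × Fin n => c x.1 = c x.2)
  have h4 : Fintype.card (Fin n × Fin n) = n ^ 2 := by simp [sq]
  simp only [ne_eq]
  omega

lemma finrank_scalarBlocks {n I : ℕ} (c : Fin n → Fin I) (hc : Function.Surjective c) :
    Module.finrank ℂ (scalarBlocks c) =
      Fintype.card {x : Fin n × Fin n // c x.1 ≠ c x.2} + I := by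
  -- `L` parametrizes `scalarBlocks c` by the off-block entries and one scalar per block.
  let L : (({x : Fin n × Fin n // c x.1 ≠ c x.2} → ℂ) × (Fin I → ℂ)) →ₗ[ℂ]
      Matrix (Fin n) (Fin n) ℂ :=
    { toFun := fun w => Matrix.of fun p q =>
        if h : c p = c q then (if p = q then w.2 (c p) else 0) else w.1 ⟨(p, q), h⟩
      map_add' := fun v w => by
        ext p q
        simp only [Matrix.of_apply, Matrix.add_apply]
        split_ifs <;> simp
      map_smul' := fun a w => by
        ext p q
        simp only [Matrix.of_apply, Matrix.smul_apply]
        split_ifs <;> simp }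
  have hL : ∀ w p q, L w p q =
      if h : c p = c q then (if p = q then w.2 (c p) else 0) else w.1 ⟨(p, q), h⟩ :=
    fun _ _ _ => rfl
  have hinj : Function.Injective L := by
    intro v w h
    have h' : ∀ p q, L v p q = L w p q := fun p q => by rw [h]
    refine Prod.ext (funext fun ⟨⟨p, q⟩, hx⟩ => ?_) (funext fun i => ?_)
    · simpa [hL, show c p ≠ c q from hx] using h' p q
    · obtain ⟨p, rfl⟩ := hc i
      simpa [hL] using h' p p
  have hrange : LinearMap.range L = scalarBlocks c := by
    ext Y
    constructor
    · rintro ⟨w, rfl⟩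
      refine ⟨w.2, ?_⟩
      ext p q
      rw [blockPart_apply, hL, Matrix.diagonal_apply]
      by_cases h : p = q
      · simp [h]
      · simp only [h, if_false]
        split_ifs <;> rfl
    · rintro ⟨t, ht⟩
      refine ⟨(fun x => Y x.1.1 x.1.2, t), ?_⟩
      ext p q
      have h := congrFun (congrFun ht p) q
      rw [blockPart_apply, Matrix.diagonal_apply] at h
      rw [hL]
      by_cases hpq : c p = c q
      · simpa [hpq] using h.symm
      · simp [hpq]
  rw [← hrange, LinearMap.finrank_range_of_inj hinj]
  simp

/-! ### Small block diagonal perturbations -/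

open Matrix in
/-- A small block diagonal perturbation which keeps the number of eigenvalues and
diagonalizability is scalar on each block. -/
lemma exists_blockPart_eq_diagonal {n I : ℕ} {k : Fin I → ℕ} (hk : ∀ i, 1 ≤ k i)
    {l : Fin I → ℂ} {c : Fin n → Fin I} (hc : Function.Surjective c)
    {Y : Matrix (Fin n) (Fin n) ℂ} {ε : ℝ}
    (hY : ∀ p q, ‖Y p q‖ ≤ ε) (hε : ∀ i j, i ≠ j → 2 * (n * ε) < ‖l i - l j‖)
    (h : diagonal (l ∘ c) + blockPart c Y ∈ diagonalizableWithMultiplicities n k) :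
    ∃ t : Fin I → ℂ, blockPart c Y = diagonal (t ∘ c) := by
  obtain ⟨T, l', c', hT, -, hc', hM⟩ := (mem_diagonalizableWithMultiplicities_iff hk _).1 h
  have hcs : Function.Surjective c' := surjective_of_card_fiber hk hc'
  have hMT : (diagonal (l ∘ c) + blockPart c Y) * T = T * diagonal (l' ∘ c') := by
    rw [hM, nonsing_inv_mul_cancel_right _ _ hT]
  -- The columns of `T` are eigenvectors; this is the eigenvector equation, read entrywise.
  have hent : ∀ p r, (l' (c' r) - l (c p)) * T p r = ∑ q, blockPart c Y p q * T q r := by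
    intro p r
    have := congrFun (congrFun hMT p) r
    rw [Matrix.add_mul, Matrix.add_apply, diagonal_mul, mul_diagonal, Matrix.mul_apply] at this
    simp only [Function.comp_apply] at this
    linear_combination -this
  -- An eigenvector with a nonzero component in a block has its eigenvalue near `l` of that block:
  -- compare the entries in the row where the component is largest.
  have hnear : ∀ p r, T p r ≠ 0 → ‖l' (c' r) - l (c p)‖ ≤ n * ε := by
    intro p r hpr
    obtain ⟨m, hm, hmax⟩ := Finset.exists_max_image (Finset.univ.filter fun q => c q = c p)
      (fun q => ‖T q r‖) ⟨p, by simp⟩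
    simp only [Finset.mem_filter, Finset.mem_univ, true_and] at hm hmax
    have hpos : 0 < ‖T m r‖ := (norm_pos_iff.2 hpr).trans_le (hmax p rfl)
    have hε0 : 0 ≤ ε := (norm_nonneg _).trans (hY p p)
    refine le_of_mul_le_mul_right ?_ hpos
    rw [← hm, ← norm_mul, hent]
    calc ‖∑ q, blockPart c Y m q * T q r‖ ≤ ∑ q : Fin n, ε * ‖T m r‖ := by
          refine norm_sum_le_of_le _ fun q _ => ?_
          rw [blockPart_apply]
          split_ifs with hq
          · rw [norm_mul]
            exact mul_le_mul (hY _ _) (hmax q (hq.symm.trans hm)) (norm_nonneg _) hε0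
          · rw [zero_mul, norm_zero]; positivity
      _ = n * ε * ‖T m r‖ := by simp [mul_assoc]
  have hTT : T * T⁻¹ = 1 := mul_nonsing_inv _ hT
  have hTT' : T⁻¹ * T = 1 := nonsing_inv_mul _ hT
  have hcol : ∀ r, ∃ p, T p r ≠ 0 := by
    intro r
    by_contra! h0
    have := congrFun (congrFun hTT' r) r
    simp [Matrix.mul_apply, h0] at this
  have hrow : ∀ p, ∃ r, T p r ≠ 0 := by
    intro p
    by_contra! h0
    have := congrFun (congrFun hTT p) p
    simp [Matrix.mul_apply, h0] at this
  -- `P j` is a position where some eigenvector for `l' j` does not vanish, so `c (P j)` is the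
  -- block attached to the eigenvalue `l' j`.
  have hex : ∀ j, ∃ p r, c' r = j ∧ T p r ≠ 0 := fun j => by
    obtain ⟨r, hr⟩ := hcs j
    obtain ⟨p, hp⟩ := hcol r
    exact ⟨p, r, hr, hp⟩
  choose P R hR hPR using hex
  -- Eigenvectors are supported in the block attached to their eigenvalue, as the `l i` are far
  -- apart.
  have hβ : ∀ p r, T p r ≠ 0 → c p = c (P (c' r)) := by
    intro p r hpr
    by_contra hne
    have h1 := hnear p r hpr
    have h2 := hnear _ _ (hPR (c' r))
    rw [hR] at h2
    have h3 := hε _ _ hne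
    have h4 := norm_sub_le (l' (c' r) - l (c (P (c' r)))) (l' (c' r) - l (c p))
    rw [sub_sub_sub_cancel_left] at h4
    linarith
  -- `T` has no zero row, so every block is attached to an eigenvalue; as there are `I` of both,
  -- to exactly one.
  have hsurj : Function.Surjective fun j => c (P j) := fun i => by
    obtain ⟨p, rfl⟩ := hc i
    obtain ⟨r, hr⟩ := hrow p
    exact ⟨c' r, (hβ p r hr).symm⟩
  let e := Equiv.ofBijective _ ⟨Finite.injective_iff_surjective.2 hsurj, hsurj⟩
  let γ : Fin I → Fin I := e.symm
  have hγ : ∀ j, γ (c (P j)) = j := e.symm_apply_apply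
  have hfin : diagonal (l ∘ c) + blockPart c Y = diagonal (l' ∘ γ ∘ c) := by
    have : (diagonal (l ∘ c) + blockPart c Y) * T = diagonal (l' ∘ γ ∘ c) * T := by
      rw [hMT]
      ext p r
      rw [mul_diagonal, diagonal_mul]
      by_cases hpr : T p r = 0
      · simp [hpr]
      · simp only [Function.comp_apply]
        rw [hβ p r hpr, hγ (c' r), mul_comm]
    rw [← mul_nonsing_inv_cancel_right T (diagonal (l ∘ c) + blockPart c Y) hT, this,
      mul_nonsing_inv_cancel_right _ _ hT]
  refine ⟨l' ∘ γ - l, ?_⟩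
  rw [eq_sub_of_add_eq' hfin, diagonal_sub]
  rfl

open Matrix in
lemma add_blockPart_mem_iff {n I : ℕ} {k : Fin I → ℕ} (hk : ∀ i, 1 ≤ k i)
    {l : Fin I → ℂ} {c : Fin n → Fin I}
    (hcard : ∀ i, (Finset.univ.filter fun p => c p = i).card = k i)
    (hc : Function.Surjective c) {Y : Matrix (Fin n) (Fin n) ℂ} {ε : ℝ}
    (hY : ∀ p q, ‖Y p q‖ ≤ ε) (hε : ∀ i j, i ≠ j → 2 * (n * ε) < ‖l i - l j‖) :
    diagonal (l ∘ c) + blockPart c Y ∈ diagonalizableWithMultiplicities n k ↔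
      Y ∈ scalarBlocks c := by
  refine ⟨exists_blockPart_eq_diagonal hk hc hY hε, ?_⟩
  rintro ⟨t, ht⟩
  rw [mem_diagonalizableWithMultiplicities_iff hk]
  refine ⟨1, l + t, c, by simp, fun i j hij => ?_, hcard, ?_⟩
  · have htb : ∀ i, ‖t i‖ ≤ n * ε := fun i => by
      obtain ⟨p, rfl⟩ := hc i
      have h := congrFun (congrFun ht p) p
      simp only [blockPart_apply, if_true, diagonal_apply_eq, Function.comp_apply] at h
      have hε0 : 0 ≤ ε := (norm_nonneg _).trans (hY p p)
      have hn : (1 : ℝ) ≤ n := by exact_mod_cast (Fin.pos p)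
      rw [← h]
      exact (hY p p).trans (le_mul_of_one_le_left hε0 hn)
    by_contra hne
    have h1 := hε i j hne
    have h2 : l i - l j = t j - t i := by
      simp only [Pi.add_apply] at hij
      linear_combination hij
    have h3 := norm_sub_le (t j) (t i)
    rw [h2] at h1
    linarith [htb i, htb j]
  · rw [ht, diagonal_add]
    simp [Pi.add_comp]

/-! ### Differentiability of matrix operations

The entrywise sup norm on matrices is not submultiplicative, so that the results on normed rings
do not apply; everything is read off from the entries.
-/

lemma ContDiff.matrix_entry {n : ℕ} (p q : Fin n) :
    ContDiff ℂ 1 fun A : Matrix (Fin n) (Fin n) ℂ => A p q :=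
  contDiff_pi.1 (contDiff_pi.1 contDiff_id p) q

lemma contDiff_matrix_det {n : ℕ} : ContDiff ℂ 1 fun A : Matrix (Fin n) (Fin n) ℂ => A.det := by
  simp only [Matrix.det_apply]
  exact ContDiff.sum fun σ _ => (contDiff_prod fun i _ => ContDiff.matrix_entry _ _).const_smul _

lemma ContDiffAt.matrix_mul {n : ℕ} {E : Type*} [NormedAddCommGroup E] [NormedSpace ℂ E]
    {f g : E → Matrix (Fin n) (Fin n) ℂ} {x : E} (hf : ContDiffAt ℂ 1 f x)
    (hg : ContDiffAt ℂ 1 g x) : ContDiffAt ℂ 1 (fun y => f y * g y) x := by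
  refine contDiffAt_pi.2 fun p => contDiffAt_pi.2 fun q => ?_
  simp only [Matrix.mul_apply]
  exact ContDiffAt.sum fun r _ => (contDiffAt_pi.1 (contDiffAt_pi.1 hf p) r).mul
    (contDiffAt_pi.1 (contDiffAt_pi.1 hg r) q)

lemma contDiff_matrix_adjugate {n : ℕ} :
    ContDiff ℂ 1 fun A : Matrix (Fin n) (Fin n) ℂ => A.adjugate := by
  refine contDiff_pi.2 fun p => contDiff_pi.2 fun q => ?_
  simp only [Matrix.adjugate_apply]
  refine contDiff_matrix_det.comp (contDiff_pi.2 fun i => contDiff_pi.2 fun j => ?_)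
  simp only [Matrix.updateRow_apply]
  split_ifs
  · exact contDiff_const
  · exact ContDiff.matrix_entry i j

lemma contDiffAt_matrix_inv {n : ℕ} {A : Matrix (Fin n) (Fin n) ℂ} (hA : IsUnit A.det) :
    ContDiffAt ℂ 1 (fun B : Matrix (Fin n) (Fin n) ℂ => B⁻¹) A := by
  simp only [Matrix.inv_def, Ring.inverse_eq_inv']
  exact (contDiff_matrix_det.contDiffAt.fun_inv hA.ne_zero).smul contDiff_matrix_adjugate.contDiffAt

lemma HasDerivAt.matrix_mul {n : ℕ} {f g : ℂ → Matrix (Fin n) (Fin n) ℂ}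
    {f' g' : Matrix (Fin n) (Fin n) ℂ} {x : ℂ} (hf : HasDerivAt f f' x)
    (hg : HasDerivAt g g' x) :
    HasDerivAt (fun y => f y * g y) (f' * g x + f x * g') x := by
  refine hasDerivAt_pi.2 fun p => hasDerivAt_pi.2 fun q => ?_
  simp only [Matrix.mul_apply, Matrix.add_apply, ← Finset.sum_add_distrib]
  exact HasDerivAt.fun_sum fun r _ => (hasDerivAt_pi.1 (hasDerivAt_pi.1 hf p) r).mul
    (hasDerivAt_pi.1 (hasDerivAt_pi.1 hg r) q)

/-! ### Straightening a subset by the inverse function theorem -/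

lemma hasDerivAt_smul_self {E : Type*} [NormedAddCommGroup E] [NormedSpace ℂ E] (x : E) :
    HasDerivAt (fun t : ℂ => t • x) x 0 := by
  simpa using (hasDerivAt_id (0 : ℂ)).smul_const x

lemma DifferentiableAt.hasDerivAt_comp_smul {E : Type*} [NormedAddCommGroup E] [NormedSpace ℂ E]
    {f : E → E} (hf : DifferentiableAt ℂ f 0) (x : E) :
    HasDerivAt (fun t : ℂ => f (t • x)) (fderiv ℂ f 0 x) 0 := by
  have h : HasFDerivAt f (fderiv ℂ f 0) ((0 : ℂ) • x) := by
    rw [zero_smul]; exact hf.hasFDerivAt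
  exact h.comp_hasDerivAt (0 : ℂ) (hasDerivAt_smul_self x)

/-- If `f` has an injective derivative at `a` and pulls `S` back to the subspace `F` near `a`, then
a local inverse of `f` straightens `S` to `F` near `f a`. -/
lemma exists_straightening {E : Type*} [NormedAddCommGroup E] [NormedSpace ℂ E]
    [FiniteDimensional ℂ E] {f : E → E} {a : E} (hf : ContDiffAt ℂ 1 f a)
    (hinj : Function.Injective (fderiv ℂ f a)) {S : Set E} {F : Submodule ℂ E}
    (hS : ∀ᶠ y in nhds a, f y ∈ S ↔ y ∈ F) :
    ∃ φ : OpenPartialHomeomorph E E, f a ∈ φ.source ∧ DifferentiableOn ℂ φ φ.source ∧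
      DifferentiableOn ℂ φ.symm φ.target ∧ ∀ y ∈ φ.source, y ∈ S ↔ φ y ∈ F := by
  have : CompleteSpace E := FiniteDimensional.complete ℂ E
  let e : E ≃L[ℂ] E :=
    (LinearEquiv.ofInjectiveEndo (fderiv ℂ f a : E →ₗ[ℂ] E) hinj).toContinuousLinearEquiv
  have he : HasFDerivAt f (e : E →L[ℂ] E) a := by
    convert! (hf.differentiableAt one_ne_zero).hasFDerivAt using 1
  obtain ⟨U, hU, hUo, haU⟩ := eventually_nhds_iff.1 hS
  -- Both restrictions shrink the domain: to where the map and its inverse are `C¹`, and to where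
  -- the description of `S` is valid.
  let ψ₀ := hf.toOpenPartialHomeomorph f he one_ne_zero
  have ha₀ : a ∈ ψ₀.source := hf.mem_toOpenPartialHomeomorph_source he one_ne_zero
  let ψ₁ := ψ₀.restrContDiff ℂ 1 (by simp)
  have ha₁ : a ∈ ψ₁.source := ⟨ha₀, hf, hf.to_localInverse he one_ne_zero⟩
  let ψ := ψ₁.restrOpen U hUo
  have ha : a ∈ ψ.source := ⟨ha₁, haU⟩
  refine ⟨ψ.symm, ψ.map_source ha, ?_, ?_, ?_⟩
  · intro y hy
    have : y ∈ ψ₁.target := hy.1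
    exact ((ψ₀.contDiffOn_restrContDiff_target (𝕜 := ℂ) (n := 1) (by simp)).differentiableOn
      one_ne_zero y this).mono fun z hz => hz.1
  · intro y hy
    have : y ∈ ψ₁.source := hy.1
    exact ((ψ₀.contDiffOn_restrContDiff_source (𝕜 := ℂ) (n := 1) (by simp)).differentiableOn
      one_ne_zero y this).mono fun z hz => hz.1
  · intro y hy
    have h1 : ψ.symm y ∈ U := (ψ.map_target hy).2
    have h2 : f (ψ.symm y) = y := ψ.right_inv hy
    have h3 := hU _ h1
    rwa [h2] at h3

/-! ### The slice chart and the dimension -/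

open Matrix in
lemma isComplexSubmanifold_diagonalizableWithMultiplicities {n I : ℕ} {k : Fin I → ℕ}
    (hk : ∀ i, 1 ≤ k i) {d : ℕ} (hd : d + ∑ i, k i ^ 2 = n ^ 2 + I) :
    IsComplexSubmanifold (diagonalizableWithMultiplicities n k) d := by
  intro A hA
  obtain ⟨T, l, c, hT, hl, hcard, rfl⟩ := (mem_diagonalizableWithMultiplicities_iff hk _).1 hA
  have hc : Function.Surjective c := surjective_of_card_fiber hk hcard
  set D : Matrix (Fin n) (Fin n) ℂ := diagonal (l ∘ c) with hD
  let Z := blockPart c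
  let G : Matrix (Fin n) (Fin n) ℂ → Matrix (Fin n) (Fin n) ℂ := fun Y => T * (1 + (Y - Z Y))
  let f : Matrix (Fin n) (Fin n) ℂ → Matrix (Fin n) (Fin n) ℂ :=
    fun Y => G Y * (D + Z Y) * (G Y)⁻¹
  have hG0 : G 0 = T := by simp [G]
  have hf0 : f 0 = T * D * T⁻¹ := by simp [f, hG0]
  have hZc : ContDiff ℂ 1 Z := (LinearMap.toContinuousLinearMap Z).contDiff
  have hGc : ContDiff ℂ 1 G := contDiff_iff_contDiffAt.2 fun Y =>
    contDiffAt_const.matrix_mul (contDiffAt_const.add (contDiffAt_id.sub hZc.contDiffAt))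
  have hG0u : IsUnit (G 0).det := by rwa [hG0]
  have hfc : ContDiffAt ℂ 1 f 0 :=
    (hGc.contDiffAt.matrix_mul (contDiffAt_const.add hZc.contDiffAt)).matrix_mul
      (ContDiffAt.comp (g := fun B : Matrix (Fin n) (Fin n) ℂ => B⁻¹) (f := G) 0
        (contDiffAt_matrix_inv hG0u) hGc.contDiffAt)
  have hGu : ∀ᶠ Y in nhds 0, IsUnit (G Y).det := by
    have : ContinuousAt (fun Y => (G Y).det) 0 :=
      (contDiff_matrix_det.continuous.comp hGc.continuous).continuousAt
    filter_upwards [this.eventually_ne hG0u.ne_zero] with Y hY using hY.isUnit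
  have hinj : Function.Injective (fderiv ℂ f 0) := by
    rw [injective_iff_map_eq_zero]
    intro H hH
    have hg : HasDerivAt (fun t : ℂ => f (t • H)) 0 0 := by
      have h := (hfc.differentiableAt one_ne_zero).hasDerivAt_comp_smul H
      exact hH ▸ h
    -- Differentiating `f (t • H) * G (t • H) = G (t • H) * (D + t • Z H)` avoids the derivative
    -- of the inverse.
    have hlin : ∀ X : Matrix (Fin n) (Fin n) ℂ, HasDerivAt (fun t : ℂ => t • X) X 0 :=
      hasDerivAt_smul_self
    have hGd : HasDerivAt (fun t : ℂ => T * (1 + t • (H - Z H))) (T * (H - Z H)) 0 := by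
      simpa using (hasDerivAt_const (0 : ℂ) T).matrix_mul ((hlin (H - Z H)).const_add 1)
    have hDd : HasDerivAt (fun t : ℂ => D + t • Z H) (Z H) 0 := (hlin (Z H)).const_add D
    have hL := hg.matrix_mul hGd
    have hR := hGd.matrix_mul hDd
    have htend : Filter.Tendsto (fun t : ℂ => t • H) (nhds 0) (nhds 0) := by
      have h : Continuous fun t : ℂ => t • H := by fun_prop
      simpa using h.tendsto 0
    have heq : (fun t : ℂ => f (t • H) * (T * (1 + t • (H - Z H)))) =ᶠ[nhds 0]
        fun t : ℂ => T * (1 + t • (H - Z H)) * (D + t • Z H) := by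
      filter_upwards [htend.eventually hGu] with t ht
      have : G (t • H) = T * (1 + t • (H - Z H)) := by simp [G, smul_sub]
      rw [← this, ← map_smul Z, nonsing_inv_mul_cancel_right _ _ ht]
    have hu := hL.unique (hR.congr_of_eventuallyEq heq)
    simp only [zero_smul, hf0, add_zero, mul_one, zero_mul, zero_add] at hu
    have hu' : D * (H - Z H) = (H - Z H) * D + Z H := by
      have h1 : T * (D * (H - Z H)) = T * ((H - Z H) * D + Z H) := by
        simpa only [Matrix.mul_add, Matrix.mul_assoc, nonsing_inv_mul_cancel_left _ _ hT] using hu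
      rw [← nonsing_inv_mul_cancel_left T (D * (H - Z H)) hT, h1,
        nonsing_inv_mul_cancel_left _ _ hT]
    -- On entries, `hu'` says that `H` vanishes in the blocks, and that off the blocks
    -- `(l (c p) - l (c q)) * H p q = 0`.
    ext p q
    have h := congrFun (congrFun hu' p) q
    rw [hD, Matrix.add_apply, diagonal_mul, mul_diagonal, Matrix.sub_apply] at h
    simp only [Z, blockPart_apply, Function.comp_apply] at h
    by_cases hpq : c p = c q
    · simpa [hpq] using h.symm
    · simp only [hpq, if_false, sub_zero, add_zero] at h
      have h2 : (l (c p) - l (c q)) * H p q = 0 := by linear_combination h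
      exact (mul_eq_zero.1 h2).resolve_left (sub_ne_zero.2 fun hh => hpq (hl hh))
  obtain ⟨ε, hε0, hε⟩ : ∃ ε : ℝ, 0 < ε ∧ ∀ i j, i ≠ j → 2 * (n * ε) < ‖l i - l j‖ := by
    have h1 : ∀ᶠ ε : ℝ in nhds 0, ∀ i j, i ≠ j → 2 * (n * ε) < ‖l i - l j‖ := by
      refine Filter.eventually_all.2 fun i => Filter.eventually_all.2 fun j => ?_
      by_cases hij : i = j
      · simp [hij]
      · have hlt : 2 * ((n : ℝ) * 0) < ‖l i - l j‖ := by
          simpa [sub_eq_zero] using fun hh => hij (hl hh)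
        have hcont : Continuous fun ε : ℝ => 2 * ((n : ℝ) * ε) := by fun_prop
        filter_upwards [hcont.continuousAt.eventually_lt continuousAt_const hlt] with ε h _ using h
    obtain ⟨ε, h, hpos⟩ :=
      ((h1.filter_mono nhdsWithin_le_nhds).and (self_mem_nhdsWithin (s := Set.Ioi 0))).exists
    exact ⟨ε, hpos, h⟩
  have hS : ∀ᶠ Y in nhds 0, f Y ∈ diagonalizableWithMultiplicities n k ↔ Y ∈ scalarBlocks c := by
    filter_upwards [hGu, Metric.ball_mem_nhds 0 hε0] with Y hY hYε
    rw [conj_mem_diagonalizableWithMultiplicities_iff hk hY]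
    refine add_blockPart_mem_iff hk hcard hc (fun p q => ?_) hε
    rw [mem_ball_zero_iff] at hYε
    exact (Matrix.norm_entry_le_entrywise_sup_norm Y).trans hYε.le
  obtain ⟨φ, h1, h2, h3, h4⟩ := exists_straightening hfc hinj hS
  refine ⟨φ, scalarBlocks c, hf0 ▸ h1, h2, h3, ?_, h4⟩
  rw [finrank_scalarBlocks c hc]
  have := card_offBlock_add c hcard
  omega

lemma diagonalizableWithMultiplicities_nonempty {n I : ℕ} {k : Fin I → ℕ} (hk : ∀ i, 1 ≤ k i)
    (hn : ∑ i, k i = n) : (diagonalizableWithMultiplicities n k).Nonempty := by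
  subst hn
  refine ⟨_, (mem_diagonalizableWithMultiplicities_iff hk _).2
    ⟨1, fun i => (i : ℂ), fun p => (finSigmaFinEquiv.symm p).1, by simp, fun i j h => ?_,
      fun i => ?_, rfl⟩⟩
  · exact Fin.ext (Nat.cast_injective (R := ℂ) h)
  · rw [← Fintype.card_subtype, Fintype.card_congr
      ((finSigmaFinEquiv.symm.subtypeEquiv fun _ => Iff.rfl).trans (Equiv.sigmaSubtype i))]
    simp

lemma hasComplexDim_diagonalizableWithMultiplicities {n I : ℕ} {k : Fin I → ℕ}
    (hk : ∀ i, 1 ≤ k i) (hn : ∑ i, k i = n) :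
    ∃ d : ℕ, HasComplexDim (diagonalizableWithMultiplicities n k) d ∧
      d + ∑ i, k i ^ 2 = n ^ 2 + I := by
  have h : ∑ i, k i ^ 2 ≤ n ^ 2 := by
    subst hn
    exact Finset.sum_sq_le_sq_sum_of_nonneg fun _ _ => Nat.zero_le _
  refine ⟨n ^ 2 - ∑ i, k i ^ 2 + I, ⟨diagonalizableWithMultiplicities_nonempty hk hn,
    isComplexSubmanifold_diagonalizableWithMultiplicities hk ?_⟩, ?_⟩ <;> omega

lemma hasComplexCodim_diagonalizableWithMultiplicities {n I : ℕ} {k : Fin I → ℕ}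
    (hk : ∀ i, 1 ≤ k i) (hn : ∑ i, k i = n) :
    ∃ c : ℕ, HasComplexCodim (diagonalizableWithMultiplicities n k) c ∧
      (c : ℤ) = ∑ i, ((k i : ℤ) ^ 2 - 1) := by
  obtain ⟨d, hd, hd'⟩ := hasComplexDim_diagonalizableWithMultiplicities hk hn
  have hs : ∑ i, (k i ^ 2 - 1) + I = ∑ i, k i ^ 2 := by
    have : ∑ i, (k i ^ 2 - 1 + 1) = ∑ i, k i ^ 2 :=
      Finset.sum_congr rfl fun i _ => Nat.sub_add_cancel (Nat.one_le_pow _ _ (hk i))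
    rw [← this, Finset.sum_add_distrib]
    simp
  refine ⟨∑ i, (k i ^ 2 - 1), ⟨d, hd, ?_⟩, ?_⟩
  · have : Module.finrank ℂ (Matrix (Fin n) (Fin n) ℂ) = n ^ 2 := by
      simp [Module.finrank_matrix, sq]
    omega
  · push_cast
    refine Finset.sum_congr rfl fun i _ => ?_
    rw [Nat.cast_sub (Nat.one_le_pow _ _ (hk i))]
    simp

theorem corollary1p2 (n : ℕ) :
    (∀ (I : ℕ) (k : Fin I → ℕ), (∀ i, 1 ≤ k i) → ∑ i, k i = n →
      (∃ d : ℕ, HasComplexDim (diagonalizableWithMultiplicities n k) d ∧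
        (d : ℤ) = (n : ℤ) ^ 2 - ∑ i, (k i : ℤ) ^ 2 + (I : ℤ) ∧
        (d : ℤ) = (n : ℤ) ^ 2 - ∑ i, ((k i : ℤ) ^ 2 - 1)) ∧
      (∃ c : ℕ, HasComplexCodim (diagonalizableWithMultiplicities n k) c ∧
        (c : ℤ) = ∑ i, ((k i : ℤ) ^ 2 - 1))) ∧
    (∀ k : ℕ, 1 ≤ k → k ≤ n →
      ∃ c : ℕ, HasComplexCodim (diagonalizableWithMultiplicities n
          (Fin.cons k (fun _ => 1) : Fin (n - k + 1) → ℕ)) c ∧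
        (c : ℤ) = (k : ℤ) ^ 2 - 1) := by
  refine ⟨fun I k hk hn => ⟨?_, hasComplexCodim_diagonalizableWithMultiplicities hk hn⟩,
    fun k hk hkn => ?_⟩
  · obtain ⟨d, hd, hd'⟩ := hasComplexDim_diagonalizableWithMultiplicities hk hn
    have h : (d : ℤ) + ∑ i, (k i : ℤ) ^ 2 = (n : ℤ) ^ 2 + I := by exact_mod_cast hd'
    refine ⟨d, hd, by linarith, ?_⟩
    rw [Finset.sum_sub_distrib]
    simp only [Finset.sum_const, Finset.card_univ, Fintype.card_fin, nsmul_eq_mul, mul_one]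
    linarith
  · obtain ⟨c, hc, hc'⟩ := hasComplexCodim_diagonalizableWithMultiplicities (n := n)
      (k := (Fin.cons k (fun _ => 1) : Fin (n - k + 1) → ℕ))
      (fun i => by refine Fin.cases ?_ (fun j => ?_) i <;> simp [hk])
      (by simp [Fin.sum_univ_succ, hkn])
    refine ⟨c, hc, ?_⟩
    rw [hc', Fin.sum_univ_succ]
    simp
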